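/- **Graphs.** For coprime natural numbers $n,k$ with $k<n-1$, let $\mathrm{CSL}(n,k)$ be the undirected simple graph on $\{0,\dots,n-1\}$ whose edges are $\{j,\,j+1 \bmod n\}$ and $\{j,\,j+k \bmod n\}$ for all $j$. An $(n,\ell)$-CSL graph is a graph on $\ell n$ nodes that is isomorphic to the disjoint union of $\ell$ pairwise non-isomorphic graphs $\mathrm{CSL}(n,k_1),\dots,\mathrm{CSL}(n,k_\ell)$. Let $\mathcal G_{n,\ell}$ be the family of all of them, with arbitrary node labellings. **Architecture.** A *subgraph* of $G=(V,E)$ is either $G$ itself (no node marked) or $S_v$, that is, $G$ with the node $v$ marked. All node features are constant, equal to $1$. An MLP consists of two affine layers of arbitrary width with ReLU in between. A message-passing layer with weights $(\varepsilon,\mathrm{MLP})$ maps $x$ to $$x'_v=\mathrm{MLP}\Big((1+\varepsilon)x_v+\sum_{u\sim v}x_u\Big).$$ An encoder with $L\ge 1$ layers starts on a subgraph $s$ from the marking $p^{(0)}_s=\chi_{v_s}$ (zero for $G$ itself) and $h^{(0)}_s=1$, computes $p^{(i)}_s=f_p^{(i)}(p^{(i-1)}_s)$ and $h^{(i)}_s=f_h^{(i)}(h^{(i-1)}_s\oplus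 p^{(i-1)}_s)$ with message-passing layers $f_p^{(i)},f_h^{(i)}$ for $i=1,\dots,L$, and returns the node representations $h_s=p^{(L)}_s+h^{(L)}_s$. * The *selection network* $f$ takes a bag (multiset) $\mathcal B$ of subgraphs, averages the representations $h_s$ of its encoder over $s\in\mathcal B$ at every node, and applies at every node an MLP with one output. Its value is a vector $f(\mathcal B)\in\mathbb R^V$. * The *prediction network* $g$, with its own weights, averages the representations of its encoder over the nodes and over the subgraphs of the bag, and applies an MLP with output in $\mathbb R^d$. With $T$ selections, the architecture starts from $\mathcal B^0=\{\!\{G\}\!\}$. For $t=0,\dots,T-1$ it draws a node $v_{t+1}$ with probability proportional to $f(\mathcal B^t)$ and sets $\mathcal B^{t+1}=\mathcal B^t\cup\{\!\{S_{v_{t+1}}\}\!\}$. It outputs $g(\mathcal B^T)$. A draw fails if $f(\mathcal B^t)$ has a negative entry or does not have a positive sum. **Theorem.** For all $n,\ell$ there exist weights of $f$ and $g$, depending only on $n$ and $\ell$ (including the numbers of layers, the widths and the output dimension $d$), such that the architecture with $T=\ell$ selections identifies the isomorphism type of every $G\in\mathcal G_{n,\ell}$ within the family. That is, there is a map $\tau$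 from the graphs on $\ell n$ nodes to $\mathbb R^d$ such that, for all $G,G'\in\mathcal G_{n,\ell}$, $$\tau(G)=\tau(G')\iff G\cong G',$$ and for every $G\in\mathcal G_{n,\ell}$, with probability $1$ no draw fails and the output on $G$ is $\tau(G)$. -/

import Mathlib

noncomputable section

/-! ### Circulant skip link graphs -/

/-- The parameters of a CSL graph: `n` and `k` are coprime and `k < n - 1`. -/
def CSLParam (n k : ℕ) : Prop :=
  Nat.Coprime n k ∧ k + 1 < n

/-- The graph `CSL(n, k)` on `{0, …, n - 1}`: the cycle edges `{j, j + 1}` and the skip links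
`{s, s + k}`, modulo `n`. -/
def cslGraph (n k : ℕ) : SimpleGraph (ZMod n) :=
  SimpleGraph.circulantGraph {1, (k : ZMod n)}

/-- Under the coprimality condition, the edges are the cycle edges together with the consecutive
pairs of the sequence `0, k, 2 k, 3 k, …` modulo `n`. -/
theorem cslGraph_adj_iff {n k : ℕ} (h : CSLParam n k) (a b : ZMod n) :
    (cslGraph n k).Adj a b ↔
      (b = a + 1 ∨ a = b + 1) ∨
        ∃ i : ℕ, (a = (i : ZMod n) * k ∧ b = ((i + 1 : ℕ) : ZMod n) * k) ∨
          (b = (i : ZMod n) * k ∧ a = ((i + 1 : ℕ) : ZMod n) * k) := by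
  obtain ⟨hc, hn⟩ := h
  have : NeZero n := ⟨by omega⟩
  have : Fact (1 < n) := ⟨by omega⟩
  have hu : (k : ZMod n) * (k : ZMod n)⁻¹ = 1 := ZMod.coe_mul_inv_eq_one k hc.symm
  have hk0 : (k : ZMod n) ≠ 0 := by
    intro h0
    rw [h0, zero_mul] at hu
    exact zero_ne_one hu
  have key : ∀ x : ZMod n, ∃ i : ℕ, x = (i : ZMod n) * k := by
    intro x
    refine ⟨(x * (k : ZMod n)⁻¹).val, ?_⟩
    rw [ZMod.natCast_val, ZMod.cast_id', id, mul_assoc, mul_comm _ (k : ZMod n), hu, mul_one]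
  have e1 : ∀ x y : ZMod n, x - y = 1 ↔ x = y + 1 := fun x y => by
    rw [sub_eq_iff_eq_add, add_comm]
  have e2 : ∀ x y : ZMod n, x - y = k ↔
      ∃ i : ℕ, y = (i : ZMod n) * k ∧ x = ((i + 1 : ℕ) : ZMod n) * k := by
    intro x y
    constructor
    · intro hxy
      obtain ⟨i, hi⟩ := key y
      refine ⟨i, hi, ?_⟩
      rw [sub_eq_iff_eq_add] at hxy
      rw [hxy, hi]; push_cast; ring
    · rintro ⟨i, rfl, rfl⟩
      push_cast; ring
  have e3 : a - b ∈ ({1, (k : ZMod n)} : Set (ZMod n)) ↔ a - b = 1 ∨ a - b = k := Iff.rfl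
  have e4 : b - a ∈ ({1, (k : ZMod n)} : Set (ZMod n)) ↔ b - a = 1 ∨ b - a = k := Iff.rfl
  have hne : (b = a + 1 ∨ a = b + 1) ∨ (a - b = k ∨ b - a = k) → a ≠ b := by
    rintro h rfl
    simp [hk0.symm] at h
  rw [exists_or, ← e2, ← e2]
  rw [cslGraph, SimpleGraph.circulantGraph, SimpleGraph.fromRel_adj, e3, e4, e1, e1]
  constructor
  · rintro ⟨-, h⟩; tauto
  · intro h
    exact ⟨hne (by tauto), by tauto⟩

/-- The disjoint union of `ℓ` graphs on (copies of) the same vertex set. -/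
def disjointUnion {ℓ : ℕ} {W : Type} (H : Fin ℓ → SimpleGraph W) : SimpleGraph (Fin ℓ × W) where
  Adj a b := a.1 = b.1 ∧ (H a.1).Adj a.2 b.2
  symm := ⟨fun _ _ h => ⟨h.1.symm, h.1 ▸ h.2.symm⟩⟩
  loopless := ⟨fun _ h => h.2.ne rfl⟩

/-- The `(n, ℓ)`-CSL graphs: all graphs on the nodes `0, …, ℓ n - 1`, with any labelling of the
nodes, that are disjoint unions of `ℓ` pairwise non-isomorphic graphs `CSL(n, k_i)`. -/
def cslFamily (n ℓ : ℕ) : Set (SimpleGraph (Fin (ℓ * n))) :=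
  {G | ∃ k : Fin ℓ → ℕ, (∀ i, CSLParam n (k i)) ∧
    (∀ i j, i ≠ j → IsEmpty (cslGraph n (k i) ≃g cslGraph n (k j))) ∧
    Nonempty (G ≃g disjointUnion fun i => cslGraph n (k i))}

/-! ### The networks -/

/-- The weights of a perceptron made of two linear layers, with ReLU in between. -/
structure MLP (ι κ : Type) where
  /-- the hidden width -/
  width : ℕ
  W₁ : Matrix (Fin width) ι ℝ
  b₁ : Fin width → ℝ
  W₂ : Matrix κ (Fin width) ℝ
  b₂ : κ → ℝ

def MLP.eval {ι κ : Type} [Fintype ι] (M : MLP ι κ) (x : ι → ℝ) : κ → ℝ :=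
  M.W₂.mulVec (fun i => max 0 (M.W₁.mulVec x i + M.b₁ i)) + M.b₂

/-- The weights of a GIN message-passing layer. -/
structure GINLayer (ι κ : Type) where
  ε : ℝ
  mlp : MLP ι κ

open Classical in
/-- A GIN layer: `x'_v = MLP ((1 + ε) x_v + ∑_{u ∼ v} x_u)`. -/
def GINLayer.eval {ι κ V : Type} [Fintype ι] [Fintype V] (N : GINLayer ι κ)
    (G : SimpleGraph V) (x : V → ι → ℝ) : V → κ → ℝ :=
  fun v => N.mlp.eval ((1 + N.ε) • x v + ∑ u with G.Adj v u, x u)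

/-- One layer of a subgraph encoder: the layer `p` updates the markings, and the layer `h` updates
the features from the concatenation of features and markings. -/
structure EncoderLayer (ι κ : Type) where
  p : GINLayer ι κ
  h : GINLayer (ι ⊕ ι) κ

/-- The state of a subgraph encoder on a graph with node set `V`: markings and features. -/
structure EncoderState (V ι : Type) where
  p : V → ι → ℝ
  h : V → ι → ℝ

/-- `p ↦ f_p(p, A)` and `h ↦ f_h(h ⊕ p, A)`. -/
def EncoderLayer.eval {ι κ V : Type} [Fintype ι] [Fintype V] (N : EncoderLayer ι κ)
    (G : SimpleGraph V) (s : EncoderState V ι) : EncoderState V κ where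
  p := N.p.eval G s.p
  h := N.h.eval G (fun v => Sum.elim (s.h v) (s.p v))

/-- The weights of a subgraph encoder with embedding dimension `c`: a first layer, which has one
input channel for the marking and one for the node features, and a list of further layers. -/
structure Encoder (c : ℕ) where
  first : EncoderLayer Unit (Fin c)
  rest : List (EncoderLayer (Fin c) (Fin c))

open Classical in
/-- The initial state. The subgraph `some r` is the graph with the node `r` marked; `none` is the
original graph, in which no node is marked. The graphs are unattributed: all features are `1`. -/
def initState {V : Type} (s : Option V) : EncoderState V Unit where
  p := fun v _ => if s = some v then 1 else 0
  h := fun _ _ => 1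

/-- The node representations of the subgraph `s`: final markings plus final features. -/
def Encoder.eval {c : ℕ} {V : Type} [Fintype V] (E : Encoder c) (G : SimpleGraph V)
    (s : Option V) : V → Fin c → ℝ :=
  let out := E.rest.foldl (fun st N => N.eval G st) (E.first.eval G (initState s))
  out.p + out.h

/-- The mean of `F` over a multiset. -/
def bagMean {α E : Type} [AddCommGroup E] [Module ℝ E] (B : Multiset α) (F : α → E) : E :=
  (B.card : ℝ)⁻¹ • (B.map F).sum

/-- The weights of a selection network. -/
structure SelectionNetwork where
  /-- the embedding dimension -/
  c : ℕ
  encoder : Encoder c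
  out : MLP (Fin c) Unit

/-- The selection network: encode each subgraph of the bag, pool over the subgraphs, and apply an
MLP with one output channel at each node. -/
def SelectionNetwork.eval {V : Type} [Fintype V] (f : SelectionNetwork) (G : SimpleGraph V)
    (B : Multiset (Option V)) : V → ℝ :=
  fun v => f.out.eval (bagMean B fun s => f.encoder.eval G s v) ()

/-- The weights of a prediction network with `d` outputs. -/
structure PredictionNetwork (d : ℕ) where
  /-- the embedding dimension -/
  c : ℕ
  encoder : Encoder c
  out : MLP (Fin c) (Fin d)

/-- The prediction network: encode each subgraph of the bag, pool over the nodes and over the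
subgraphs, and apply an MLP. -/
def PredictionNetwork.eval {d : ℕ} {V : Type} [Fintype V] (g : PredictionNetwork d)
    (G : SimpleGraph V) (B : Multiset (Option V)) : Fin d → ℝ :=
  g.out.eval (bagMean B fun s => bagMean (Finset.univ : Finset V).val fun v =>
    g.encoder.eval G s v)

/-! ### The sequential selection -/

/-- `w` is an un-normalized probability distribution. -/
def IsUnnormalized {V : Type} [Fintype V] (w : V → ℝ) : Prop :=
  (∀ v, 0 ≤ w v) ∧ 0 < ∑ v, w v

theorem tsum_ofReal_ne_zero {V : Type} [Fintype V] {w : V → ℝ} (h : IsUnnormalized w) :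
    ∑' v, ENNReal.ofReal (w v) ≠ 0 := by
  rw [tsum_fintype, ← ENNReal.ofReal_sum_of_nonneg fun v _ => h.1 v]
  exact (ENNReal.ofReal_pos.2 h.2).ne'

theorem tsum_ofReal_ne_top {V : Type} [Fintype V] (w : V → ℝ) :
    ∑' v, ENNReal.ofReal (w v) ≠ ⊤ := by
  rw [tsum_fintype]
  exact (ENNReal.sum_lt_top.2 fun _ _ => ENNReal.ofReal_lt_top).ne

open Classical in
/-- Draw `v` with probability `w v / ∑ u, w u`; the draw fails, with result `none`, when `w` is not
an un-normalized probability distribution. -/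
def draw {V : Type} [Fintype V] (w : V → ℝ) : PMF (Option V) :=
  if h : IsUnnormalized w then
    (PMF.normalize (fun v => ENNReal.ofReal (w v)) (tsum_ofReal_ne_zero h)
      (tsum_ofReal_ne_top w)).map some
  else PMF.pure none

/-- The law of the bag after `t` selections; `none` means that some draw has failed. -/
def bagLaw {V : Type} [Fintype V] (f : SelectionNetwork) (G : SimpleGraph V) :
    ℕ → PMF (Option (Multiset (Option V)))
  | 0 => PMF.pure (some {none})
  | t + 1 => (bagLaw f G t).bind fun
      | none => PMF.pure none
      | some B => (draw (f.eval G B)).map (Option.map fun v => some v ::ₘ B)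

/-- The law of the output of the whole architecture on `G`, with `T` selections. -/
def outputLaw {d : ℕ} {V : Type} [Fintype V] (f : SelectionNetwork) (g : PredictionNetwork d)
    (T : ℕ) (G : SimpleGraph V) : PMF (Option (Fin d → ℝ)) :=
  (bagLaw f G T).map (Option.map (g.eval G))

end

/-!
The architecture computes a spectral invariant that separates the family.

*The invariant.* Write `A` for the adjacency matrix of a graph and `S_k = {±1, ±k} ⊆ ℤ/n` for the
connection set of `CSL(n, k)`. If `p` is a prime, Frobenius in the group algebra `𝔽_p[ℤ/n]` shows
that modulo `p` the number of closed walks of length `p + 1` in `CSL(n, k)` is `n` times the number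
of pairs `(s, t)` in `S_k × S_k` with `p s + t = 0` (`trace_loopedAdj_cslGraph_pow_prime`). By
Dirichlet's theorem `p` can be taken large and congruent to any `κ` coprime to `n`. If `κ ≠ ±1`,
such a pair exists only for `k = ±κ` and `k = ±κ⁻¹`, and then `CSL(n, k)` and `CSL(n, κ)` are
isomorphic by multiplication with a unit. So the number of closed walks of length `p + 1` in a
disjoint union shows whether `CSL(n, κ)` is a component (`exists_component_iso`). As the components
are pairwise non-isomorphic and their number is fixed, this also decides the remaining case
`κ = 1`. Hence the numbers `tr (A ^ j)`, for finitely many `j`, identify the members of the family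
(`exists_closedWalk_bound`). For a transcendental number `z` they are all determined by the single
real number `tr ((z + A) ^ N)`, if `N` is large (`trace_loopedAdj_pow_eq_of_transcendental`).

*The networks.* A message-passing layer with `1 + ε = z` multiplies nonnegative markings by
`z + A`. With `z = 1`, the selection network spreads each marking over its component, and it gives
weight `0` to the visited components and weight `1` to the others (`cslSelection_eval_of_mem`,
`cslSelection_eval_of_notMem`). So after `ℓ` selections there is exactly one marked node in each
component (`bagLaw_cslSelection_support`). With transcendental `z`, the prediction network computes
the column of `(z + A) ^ N` at the marked node `r` and squares its entries in the last layer, which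
is possible because only finitely many values occur. Their sum is the diagonal entry of
`(z + A) ^ (2 * N)` at `r`. Since the components are vertex-transitive with `n` nodes each, the sum
over the roots is `tr ((z + A) ^ (2 * N)) / n` (`exists_predictionNetwork`).
-/

/-! ### Circulant skip link graphs as Cayley graphs -/

/-- The connection set `{±1, ±k}` of `CSL(n, k)` in `ℤ/n`. -/
def connectionSet (n k : ℕ) : Finset (ZMod n) :=
  {1, -1, (k : ZMod n), -(k : ZMod n)}

theorem mem_connectionSet {n k : ℕ} {x : ZMod n} :
    x ∈ connectionSet n k ↔ x = 1 ∨ x = -1 ∨ x = k ∨ x = -(k : ZMod n) := by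
  simp [connectionSet]

theorem CSLParam.three_le {n k : ℕ} (h : CSLParam n k) : 3 ≤ n ∧ 1 ≤ k := by
  obtain ⟨hc, hn⟩ := h
  have hk : k ≠ 0 := by
    rintro rfl
    rw [Nat.coprime_zero_right] at hc
    omega
  by_contra hlt
  have h1 : k = 0 ∨ n ≤ 2 := by omega
  omega

theorem CSLParam.mul_inv {n k : ℕ} (h : CSLParam n k) :
    (k : ZMod n) * (k : ZMod n)⁻¹ = 1 :=
  ZMod.coe_mul_inv_eq_one k h.1.symm

theorem CSLParam.isUnit {n k : ℕ} (h : CSLParam n k) : IsUnit (k : ZMod n) :=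
  IsUnit.of_mul_eq_one _ h.mul_inv

theorem CSLParam.cast_ne_zero {n k : ℕ} (h : CSLParam n k) : (k : ZMod n) ≠ 0 := by
  have : Fact (1 < n) := ⟨by have := h.three_le; omega⟩
  exact h.isUnit.ne_zero

/-- Apart from `k = 1`, the residue `k` is different from `±1`. -/
theorem CSLParam.cast_ne_one {n k : ℕ} (h : CSLParam n k) (hk : k ≠ 1) :
    (k : ZMod n) ≠ 1 ∧ (k : ZMod n) ≠ -1 := by
  have h3 := h.three_le
  have hn := h.2
  constructor
  · intro he
    have he' : ((k : ℕ) : ZMod n) = ((1 : ℕ) : ZMod n) := by simpa using he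
    rw [ZMod.natCast_eq_natCast_iff', Nat.mod_eq_of_lt (by omega), Nat.mod_eq_of_lt (by omega)]
      at he'
    exact hk he'
  · intro he
    have he' : ((k + 1 : ℕ) : ZMod n) = 0 := by push_cast; rw [he]; ring
    rw [ZMod.natCast_eq_zero_iff] at he'
    exact absurd (Nat.le_of_dvd (by omega) he') (by omega)

theorem cslGraph_adj_iff_sub_mem {n k : ℕ} (h : CSLParam n k) (a b : ZMod n) :
    (cslGraph n k).Adj a b ↔ b - a ∈ connectionSet n k := by
  have : Fact (1 < n) := ⟨by have := h.three_le; omega⟩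
  have hk0 := h.cast_ne_zero
  rw [cslGraph, SimpleGraph.circulantGraph, SimpleGraph.fromRel_adj, mem_connectionSet]
  have e1 : a - b = 1 ↔ b - a = -1 := by rw [← neg_sub b a, neg_eq_iff_eq_neg]
  have e2 : a - b = k ↔ b - a = -(k : ZMod n) := by rw [← neg_sub b a, neg_eq_iff_eq_neg]
  simp only [Set.mem_insert_iff, Set.mem_singleton_iff, e1, e2]
  constructor
  · tauto
  · intro hx
    refine ⟨?_, by tauto⟩
    rintro rfl
    simp [hk0, hk0.symm] at hx

theorem zero_notMem_connectionSet {n k : ℕ} (h : CSLParam n k) :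
    (0 : ZMod n) ∉ connectionSet n k :=
  fun h0 => ((cslGraph_adj_iff_sub_mem h 0 0).2 (by simpa using h0)).ne rfl

/-- Multiplication by a unit `u` with `u {±1, ±k} = {±1, ±k'}` is an isomorphism. Here `u = 1` if
`k' = ±k`, and `u = k'` if `k k' = ±1`. -/
theorem cslGraph_iso_of_cast_eq {n k k' : ℕ} (h : CSLParam n k) (h' : CSLParam n k')
    (hk : (k' : ZMod n) = k ∨ (k' : ZMod n) = -k ∨ (k : ZMod n) * k' = 1 ∨
      (k : ZMod n) * k' = -1) :
    Nonempty (cslGraph n k ≃g cslGraph n k') := by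
  obtain ⟨u, hu⟩ : ∃ u : (ZMod n)ˣ, ∀ x : ZMod n,
      u * x ∈ connectionSet n k' ↔ x ∈ connectionSet n k := by
    simp only [mem_connectionSet]
    rcases hk with hk | hk | hk | hk
    · exact ⟨1, fun x => by simp [hk]⟩
    · refine ⟨1, fun x => ?_⟩
      simp only [Units.val_one, one_mul, hk, neg_neg]
      tauto
    · refine ⟨h'.isUnit.unit, fun x => ?_⟩
      have e : ∀ y : ZMod n, (k' : ZMod n) * x = y ↔ x = k * y := fun y =>
        ⟨fun hy => by rw [← hy, ← mul_assoc, hk, one_mul],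
          fun hy => by rw [hy, ← mul_assoc, mul_comm (k' : ZMod n), hk, one_mul]⟩
      simp only [IsUnit.unit_spec, e, mul_neg, mul_one, hk]
      tauto
    · refine ⟨h'.isUnit.unit, fun x => ?_⟩
      have e : ∀ y : ZMod n, (k' : ZMod n) * x = y ↔ x = -(k * y) := fun y =>
        ⟨fun hy => by rw [← hy, ← mul_assoc, hk]; ring,
          fun hy => by rw [hy, mul_neg, ← mul_assoc, mul_comm (k' : ZMod n), hk]; ring⟩
      simp only [IsUnit.unit_spec, e, mul_neg, mul_one, hk, neg_neg]
      tauto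
  refine ⟨⟨u.mulLeft, fun {a b} => ?_⟩⟩
  rw [cslGraph_adj_iff_sub_mem h, cslGraph_adj_iff_sub_mem h']
  change (u : ZMod n) * b - u * a ∈ _ ↔ _
  rw [← mul_sub, hu]

/-! ### Powers of the adjacency matrix -/

open Classical in
/-- The matrix `z + A`, where `A` is the adjacency matrix of `G`. A linear message-passing layer
with `1 + ε = z` multiplies the node features by it, and `z = 0` gives `A` itself. -/
noncomputable def loopedAdj {R V : Type} [Zero R] [One R] (z : R) (G : SimpleGraph V) :
    Matrix V V R :=
  Matrix.of fun u v => if u = v then z else if G.Adj u v then 1 else 0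

theorem loopedAdj_transpose {R V : Type} [Zero R] [One R] (z : R) (G : SimpleGraph V) :
    (loopedAdj z G).transpose = loopedAdj z G := by
  ext u v
  classical
  simp only [Matrix.transpose_apply, loopedAdj, Matrix.of_apply, G.adj_comm v u,
    eq_comm (a := v) (b := u)]

theorem loopedAdj_eq_add {R V : Type} [CommRing R] [DecidableEq V] (z : R) (G : SimpleGraph V) :
    loopedAdj z G = loopedAdj 0 G + z • (1 : Matrix V V R) := by
  ext u v
  by_cases h : u = v <;> simp [loopedAdj, h]

theorem loopedAdj_map {R R' V : Type} [CommRing R] [CommRing R'] (f : R →+* R') (z : R)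
    (G : SimpleGraph V) : (loopedAdj z G).map f = loopedAdj (f z) G := by
  ext u v
  simp only [loopedAdj, Matrix.map_apply, Matrix.of_apply]
  split_ifs <;> simp

theorem trace_loopedAdj_pow_map {R R' V : Type} [CommRing R] [CommRing R'] [Fintype V]
    [DecidableEq V] (f : R →+* R') (z : R) (G : SimpleGraph V) (m : ℕ) :
    f ((loopedAdj z G ^ m).trace) = (loopedAdj (f z) G ^ m).trace := by
  rw [← loopedAdj_map, ← RingHom.mapMatrix_apply, ← map_pow]
  simp [Matrix.trace]

theorem loopedAdj_cslGraph_apply {R : Type} [Zero R] [One R] {n k : ℕ} (h : CSLParam n k) (z : R)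
    (a b : ZMod n) : loopedAdj z (cslGraph n k) a b =
      if b - a = 0 then z else if b - a ∈ connectionSet n k then 1 else 0 := by
  simp only [loopedAdj, Matrix.of_apply, cslGraph_adj_iff_sub_mem h, sub_eq_zero, eq_comm (a := b)]

/-- The powers of `z + A` are invariant under translations. -/
theorem loopedAdj_cslGraph_pow_add {R : Type} [CommRing R] {n k : ℕ} [NeZero n]
    (h : CSLParam n k) (z : R) (m : ℕ) (a b x : ZMod n) :
    (loopedAdj z (cslGraph n k) ^ m) (a + x) (b + x) = (loopedAdj z (cslGraph n k) ^ m) a b := by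
  induction m generalizing b with
  | zero => simp [Matrix.one_apply]
  | succ m ih =>
    rw [pow_succ, Matrix.mul_apply, Matrix.mul_apply, ← Equiv.sum_comp (Equiv.addRight x)]
    simp only [Equiv.coe_addRight, ih, loopedAdj_cslGraph_apply h, add_sub_add_right_eq_sub]

/-- The components of a CSL graph are vertex-transitive, so closed walks are equally numerous at
all nodes. -/
theorem loopedAdj_cslGraph_pow_diag {n k : ℕ} [NeZero n]
    (h : CSLParam n k) (z : ℝ) (m : ℕ) (a : ZMod n) :
    (loopedAdj z (cslGraph n k) ^ m) a a = (n : ℝ)⁻¹ * (loopedAdj z (cslGraph n k) ^ m).trace := by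
  have hd : ∀ b, (loopedAdj z (cslGraph n k) ^ m) b b =
      (loopedAdj z (cslGraph n k) ^ m) a a := fun b => by
    simpa using (loopedAdj_cslGraph_pow_add h z m b b (a - b)).symm
  have hn : (n : ℝ) ≠ 0 := NeZero.ne _
  simp [Matrix.trace, hd, ZMod.card, hn]

theorem loopedAdj_pow_nonneg {V : Type} [Fintype V] [DecidableEq V] {z : ℝ} (hz : 0 ≤ z)
    (G : SimpleGraph V) (m : ℕ) (u v : V) : 0 ≤ (loopedAdj z G ^ m) u v := by
  induction m generalizing v with
  | zero => simp only [pow_zero, Matrix.one_apply]; split_ifs <;> norm_num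
  | succ m ih =>
    rw [pow_succ, Matrix.mul_apply]
    refine Finset.sum_nonneg fun w _ => mul_nonneg (ih w) ?_
    simp only [loopedAdj, Matrix.of_apply]
    split_ifs <;> first | exact hz | norm_num

/-- Lazy walks of length `m` along the cycle edges reach every node up to `m` steps ahead. -/
theorem one_le_loopedAdj_cslGraph_pow {n k : ℕ} [NeZero n] (h : CSLParam n k) (m j : ℕ)
    (hj : j ≤ m) (a : ZMod n) : 1 ≤ (loopedAdj (1 : ℝ) (cslGraph n k) ^ m) a (a + j) := by
  have hent : ∀ x y : ZMod n, (y - x = 0 ∨ y - x = 1) →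
      loopedAdj (1 : ℝ) (cslGraph n k) x y = 1 := by
    intro x y hxy
    rw [loopedAdj_cslGraph_apply h]
    rcases hxy with hxy | hxy <;> simp [hxy, mem_connectionSet]
  have step : ∀ (m : ℕ) (b c : ZMod n), (c - b = 0 ∨ c - b = 1) →
      (loopedAdj (1 : ℝ) (cslGraph n k) ^ m) a b ≤
        (loopedAdj (1 : ℝ) (cslGraph n k) ^ (m + 1)) a c := by
    intro m b c hbc
    rw [pow_succ, Matrix.mul_apply]
    calc _ = (loopedAdj (1 : ℝ) (cslGraph n k) ^ m) a b * loopedAdj (1 : ℝ) (cslGraph n k) b c := by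
          rw [hent b c hbc, mul_one]
      _ ≤ _ := Finset.single_le_sum
          (f := fun b => (loopedAdj (1 : ℝ) (cslGraph n k) ^ m) a b *
            loopedAdj (1 : ℝ) (cslGraph n k) b c)
          (fun w _ => mul_nonneg (loopedAdj_pow_nonneg zero_le_one _ _ _ _) (by
            simpa using loopedAdj_pow_nonneg zero_le_one (cslGraph n k) 1 w c))
          (Finset.mem_univ b)
  induction m generalizing j with
  | zero =>
    obtain rfl : j = 0 := by omega
    simp
  | succ m ih =>
    rcases Nat.lt_or_ge m j with hlt | hle
    · obtain rfl : j = m + 1 := by omega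
      exact (ih m le_rfl).trans (step m _ _ (Or.inr (by push_cast; ring)))
    · exact (ih j hle).trans (step m _ _ (Or.inl (sub_self _)))

/-! ### Closed walks modulo a prime -/

/-- The matrix of the translation by `x`. -/
def translationMatrix (R : Type) [CommRing R] {n : ℕ} [NeZero n] :
    Multiplicative (ZMod n) →* Matrix (ZMod n) (ZMod n) R where
  toFun x := Matrix.of fun a b => if b - a = x.toAdd then 1 else 0
  map_one' := by
    ext a b
    simp [Matrix.one_apply, sub_eq_zero, eq_comm]
  map_mul' x y := by
    ext a b
    simp only [Matrix.mul_apply, Matrix.of_apply, toAdd_mul, mul_ite, mul_one, mul_zero]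
    rw [Finset.sum_eq_single (b - y.toAdd)]
    · simp only [sub_sub_cancel, if_true]
      simp only [sub_eq_iff_eq_add, add_right_comm]
    · intro c _ hc
      rw [if_neg]
      rintro hbc
      exact hc (by rw [← hbc]; ring)
    · simp

/-- Frobenius in the group algebra of `ℤ/n` over `ℤ/p`: modulo `p`, the walks of length `p` from
`0` end in the points of `p {±1, ±k}`, once for each point. Hence the closed walks of length
`p + 1` count the coincidences between `p {±1, ±k}` and `{±1, ±k}`. -/
theorem trace_loopedAdj_cslGraph_pow_prime {n k p : ℕ} [NeZero n] [Fact p.Prime]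
    (h : CSLParam n k) :
    (loopedAdj (0 : ZMod p) (cslGraph n k) ^ (p + 1)).trace =
      ((n * ((connectionSet n k ×ˢ connectionSet n k).filter
        fun st => (p : ZMod n) * st.1 + st.2 = 0).card : ℕ) : ZMod p) := by
  let φ := AddMonoidAlgebra.lift (ZMod p) (Matrix (ZMod n) (ZMod n) (ZMod p)) (ZMod n)
    (translationMatrix (ZMod p))
  let a : AddMonoidAlgebra (ZMod p) (ZMod n) :=
    ∑ s ∈ connectionSet n k, AddMonoidAlgebra.single s 1
  have hφ : ∀ x : ZMod n, φ (AddMonoidAlgebra.single x 1) =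
      translationMatrix (ZMod p) (Multiplicative.ofAdd x) := fun x => by
    simp [φ, AddMonoidAlgebra.lift_single]
  have hA : φ a = loopedAdj (0 : ZMod p) (cslGraph n k) := by
    ext x y
    simp only [a, map_sum, hφ, Matrix.sum_apply, translationMatrix, MonoidHom.coe_mk,
      OneHom.coe_mk, Matrix.of_apply, toAdd_ofAdd, Finset.sum_ite_eq, loopedAdj_cslGraph_apply h]
    have h0 := zero_notMem_connectionSet h
    by_cases hxy : y - x = 0
    · simp [hxy, h0]
    · simp [hxy]
  have : CharP (AddMonoidAlgebra (ZMod p) (ZMod n)) p := charP_of_injective_algebraMap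
    (FaithfulSMul.algebraMap_injective (ZMod p) (AddMonoidAlgebra (ZMod p) (ZMod n))) p
  have hpow : a ^ (p + 1) = ∑ st ∈ connectionSet n k ×ˢ connectionSet n k,
      AddMonoidAlgebra.single ((p : ZMod n) * st.1 + st.2) 1 := by
    rw [pow_succ, sum_pow_char, Finset.sum_product, Finset.sum_mul_sum]
    simp [AddMonoidAlgebra.single_pow, AddMonoidAlgebra.single_mul_single]
  have htr : ∀ x : ZMod n, (translationMatrix (ZMod p) (Multiplicative.ofAdd x)).trace =
      if x = 0 then (n : ZMod p) else 0 := fun x => by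
    simp [translationMatrix, Matrix.trace, eq_comm (a := (0 : ZMod n)), ZMod.card]
  rw [← hA, ← map_pow, hpow, map_sum, Matrix.trace_sum]
  simp only [hφ, htr]
  rw [← Finset.sum_filter, Finset.sum_const, nsmul_eq_mul]
  push_cast
  ring

/-- A coincidence between `κ {±1, ±k}` and `{±1, ±k}`, with `κ ≠ ±1`, means `k = ±κ^{±1}`. -/
theorem cast_eq_of_mul_add_eq_zero {n k κ : ℕ} (h : CSLParam n k) (hκ : CSLParam n κ)
    (h1 : κ ≠ 1) {s t : ZMod n} (hs : s ∈ connectionSet n k) (ht : t ∈ connectionSet n k)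
    (hst : (κ : ZMod n) * s + t = 0) :
    (k : ZMod n) = κ ∨ (k : ZMod n) = -κ ∨ (κ : ZMod n) * k = 1 ∨ (κ : ZMod n) * k = -1 := by
  obtain ⟨ha, hb⟩ := hκ.cast_ne_one h1
  have hc : ∀ e : ZMod n, (κ : ZMod n) * k = e * k → (κ : ZMod n) = e :=
    fun e he => h.isUnit.mul_right_cancel he
  have hc1 : (κ : ZMod n) * k ≠ k := fun he => ha (hc 1 (by rw [he, one_mul]))
  have hc2 : (κ : ZMod n) * k ≠ -k := fun he => hb (hc (-1) (by rw [he]; ring))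
  rw [mem_connectionSet] at hs ht
  rw [add_eq_zero_iff_eq_neg] at hst
  rcases hs with rfl | rfl | rfl | rfl <;> rcases ht with rfl | rfl | rfl | rfl <;>
    (try simp only [mul_neg, mul_one, neg_neg, neg_eq_iff_eq_neg] at hst) <;>
    first
    | exact absurd hst ha
    | exact absurd hst hb
    | exact absurd hst hc1
    | exact absurd hst hc2
    | simp [hst]

/-! ### Disjoint unions -/

/-- `z + A` is block diagonal on a disjoint union, and so are its powers. -/
theorem loopedAdj_pow_apply_of_iso {R V W : Type} [CommRing R] [Fintype V] [DecidableEq V]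
    [Fintype W] [DecidableEq W] {ℓ : ℕ} {G : SimpleGraph V} {H : Fin ℓ → SimpleGraph W}
    (e : G ≃g disjointUnion H) (z : R) (m : ℕ) (u v : V) :
    (loopedAdj z G ^ m) u v =
      if (e u).1 = (e v).1 then (loopedAdj z (H (e u).1) ^ m) (e u).2 (e v).2 else 0 := by
  classical
  let f : V ≃ W × Fin ℓ := e.toEquiv.trans (Equiv.prodComm _ _)
  have h1 : loopedAdj z G = (Matrix.blockDiagonal fun i => loopedAdj z (H i)).submatrix f f := by
    ext a b
    have hadj : G.Adj a b ↔ (e a).1 = (e b).1 ∧ (H (e a).1).Adj (e a).2 (e b).2 :=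
      e.map_adj_iff.symm
    have hab : a = b ↔ (e a).1 = (e b).1 ∧ (e a).2 = (e b).2 := by
      rw [← Prod.ext_iff, e.injective.eq_iff]
    change _ = Matrix.blockDiagonal (fun i => loopedAdj z (H i)) ((e a).2, (e a).1)
      ((e b).2, (e b).1)
    simp only [Matrix.blockDiagonal_apply, loopedAdj, Matrix.of_apply, hab, hadj]
    by_cases h : (e a).1 = (e b).1 <;> simp [h]
  have h2 : ∀ m, loopedAdj z G ^ m =
      (Matrix.blockDiagonal fun i => loopedAdj z (H i) ^ m).submatrix f f := by
    intro m
    have h3 : ∀ M : Matrix (W × Fin ℓ) (W × Fin ℓ) R,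
        M.submatrix f f ^ m = (M ^ m).submatrix f f := by
      intro M
      induction m with
      | zero => simp
      | succ m ih => rw [pow_succ, pow_succ, ih, Matrix.submatrix_mul_equiv]
    rw [h1, h3, ← Matrix.blockDiagonal_pow]
    rfl
  rw [h2]
  exact Matrix.blockDiagonal_apply (fun i => loopedAdj z (H i) ^ m) ((e u).2, (e u).1)
    ((e v).2, (e v).1)

theorem trace_loopedAdj_pow_of_iso {R V W : Type} [CommRing R] [Fintype V] [DecidableEq V]
    [Fintype W] [DecidableEq W] {ℓ : ℕ} {G : SimpleGraph V} {H : Fin ℓ → SimpleGraph W}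
    (e : G ≃g disjointUnion H) (z : R) (m : ℕ) :
    (loopedAdj z G ^ m).trace = ∑ i, (loopedAdj z (H i) ^ m).trace := by
  simp only [Matrix.trace, Matrix.diag_apply, loopedAdj_pow_apply_of_iso e, if_true]
  rw [← Fintype.sum_prod_type' fun i a => (loopedAdj z (H i) ^ m) a a]
  exact e.toEquiv.sum_comp fun x => (loopedAdj z (H x.1) ^ m) x.2 x.2

theorem nonempty_iso_disjointUnion {ℓ : ℕ} {W : Type} {H H' : Fin ℓ → SimpleGraph W}
    (σ : Fin ℓ ≃ Fin ℓ) (h : ∀ i, Nonempty (H i ≃g H' (σ i))) :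
    Nonempty (disjointUnion H ≃g disjointUnion H') := by
  have φ := fun i => (h i).some
  refine ⟨⟨(Equiv.prodShear σ fun i => (φ i).toEquiv), fun {a b} => ?_⟩⟩
  obtain ⟨i, a⟩ := a
  obtain ⟨j, b⟩ := b
  change (σ i = σ j ∧ (H' (σ i)).Adj (φ i a) (φ j b)) ↔ i = j ∧ (H i).Adj a b
  rw [σ.injective.eq_iff]
  refine and_congr_right ?_
  rintro rfl
  exact (φ i).map_adj_iff

theorem trace_loopedAdj_pow_eq_of_iso {R V : Type} [CommRing R] [Fintype V]
    [DecidableEq V] {G G' : SimpleGraph V} (e : G ≃g G') (z : R) (m : ℕ) :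
    (loopedAdj z G ^ m).trace = (loopedAdj z G' ^ m).trace := by
  have e' : G ≃g disjointUnion fun _ : Fin 1 => G' :=
    ⟨e.toEquiv.trans (Equiv.uniqueProd V (Fin 1)).symm, fun {a b} => by
      change ((0 : Fin 1) = 0 ∧ G'.Adj (e a) (e b)) ↔ _
      rw [e.map_adj_iff]
      simp⟩
  rw [trace_loopedAdj_pow_of_iso e']
  simp

/-! ### Numbers of closed walks identify the members of the family -/

/-- If `p` is a large prime with `p ≡ κ` modulo `n`, the number of closed walks of length `p + 1`
is divisible by `p` exactly when no component is isomorphic to `CSL(n, κ)`. So a component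
`CSL(n, k i)` with `k i ≠ 1` is visible in the number of closed walks, and occurs in both graphs
if the numbers agree. -/
theorem exists_component_iso {V : Type} [Fintype V] [DecidableEq V] {n ℓ p : ℕ} [NeZero n]
    [Fact p.Prime] {k k' : Fin ℓ → ℕ} {G G' : SimpleGraph V}
    (hk : ∀ i, CSLParam n (k i)) (hk' : ∀ i, CSLParam n (k' i))
    (e : G ≃g disjointUnion fun i => cslGraph n (k i))
    (e' : G' ≃g disjointUnion fun i => cslGraph n (k' i))
    (i : Fin ℓ) (hi : k i ≠ 1) (hpi : (p : ZMod n) = k i) (hp : ℓ * (n * 16) < p)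
    (htr : (loopedAdj (0 : ℤ) G ^ (p + 1)).trace = (loopedAdj (0 : ℤ) G' ^ (p + 1)).trace) :
    ∃ j, Nonempty (cslGraph n (k i) ≃g cslGraph n (k' j)) := by
  let P : (κ : ℕ) → Finset (ZMod n × ZMod n) := fun κ =>
    (connectionSet n κ ×ˢ connectionSet n κ).filter fun st => (p : ZMod n) * st.1 + st.2 = 0
  have key : ∀ {G : SimpleGraph V} {k : Fin ℓ → ℕ} (_ : ∀ i, CSLParam n (k i))
      (_ : G ≃g disjointUnion fun i => cslGraph n (k i)),
      (((loopedAdj (0 : ℤ) G ^ (p + 1)).trace : ℤ) : ZMod p) =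
        ((∑ i, n * (P (k i)).card : ℕ) : ZMod p) := by
    intro G k hk e
    have h := trace_loopedAdj_pow_map (Int.castRingHom (ZMod p)) 0 G (p + 1)
    rw [map_zero, eq_intCast] at h
    rw [h, trace_loopedAdj_pow_of_iso e, Nat.cast_sum]
    exact Finset.sum_congr rfl fun i _ => trace_loopedAdj_cslGraph_pow_prime (hk i)
  by_contra hne
  push Not at hne
  have hzero : ∀ j, (P (k' j)).card = 0 := by
    intro j
    rw [Finset.card_eq_zero, Finset.filter_eq_empty_iff]
    rintro ⟨s, t⟩ hst h0
    rw [Finset.mem_product] at hst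
    rw [hpi] at h0
    exact (hne j).false (cslGraph_iso_of_cast_eq (hk i) (hk' j)
      (cast_eq_of_mul_add_eq_zero (hk' j) (hk i) hi hst.1 hst.2 h0)).some
  have hdvd : p ∣ ∑ i, n * (P (k i)).card := by
    rw [← ZMod.natCast_eq_zero_iff, ← key hk e, htr, key hk' e']
    simp [hzero]
  have hcard : ∀ κ, (P κ).card ≤ 16 := by
    intro κ
    have h4 : (connectionSet n κ).card ≤ 4 := Finset.card_le_four
    calc (P κ).card ≤ (connectionSet n κ ×ˢ connectionSet n κ).card := Finset.card_filter_le _ _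
      _ = (connectionSet n κ).card * (connectionSet n κ).card := Finset.card_product _ _
      _ ≤ 4 * 4 := Nat.mul_le_mul h4 h4
  have hle : ∑ i, n * (P (k i)).card ≤ ℓ * (n * 16) :=
    (Finset.sum_le_card_nsmul _ _ (n * 16) fun i _ => Nat.mul_le_mul_left n (hcard (k i))).trans
      (by simp)
  have hpos : 0 < ∑ i, n * (P (k i)).card := by
    refine Finset.sum_pos' (fun _ _ => Nat.zero_le _) ⟨i, Finset.mem_univ i, ?_⟩
    refine Nat.mul_pos (NeZero.pos n) (Finset.card_pos.2 ⟨(1, -(k i : ZMod n)), ?_⟩)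
    simp [P, mem_connectionSet, hpi]
  exact absurd (Nat.le_of_dvd hpos hdvd) (by omega)

/-- Matching the components other than `CSL(n, 1)` in both directions is enough: the components
are pairwise non-isomorphic and equally many. -/
theorem nonempty_iso_of_components {n ℓ : ℕ} {k k' : Fin ℓ → ℕ}
    (hk : ∀ i j, i ≠ j → IsEmpty (cslGraph n (k i) ≃g cslGraph n (k j)))
    (hk' : ∀ i j, i ≠ j → IsEmpty (cslGraph n (k' i) ≃g cslGraph n (k' j)))
    (h : ∀ i, k i ≠ 1 → ∃ j, Nonempty (cslGraph n (k i) ≃g cslGraph n (k' j)))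
    (h' : ∀ i, k' i ≠ 1 → ∃ j, Nonempty (cslGraph n (k' i) ≃g cslGraph n (k j))) :
    Nonempty ((disjointUnion fun i => cslGraph n (k i)) ≃g
      disjointUnion fun i => cslGraph n (k' i)) := by
  have main : ∀ {k k' : Fin ℓ → ℕ},
      (∀ i j, i ≠ j → IsEmpty (cslGraph n (k i) ≃g cslGraph n (k j))) →
      (∀ i, ∃ j, Nonempty (cslGraph n (k i) ≃g cslGraph n (k' j))) →
      Nonempty ((disjointUnion fun i => cslGraph n (k i)) ≃g
        disjointUnion fun i => cslGraph n (k' i)) := by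
    intro k k' hk hall
    choose σ hσ using hall
    have hinj : Function.Injective σ := by
      intro i j hij
      by_contra hne
      exact (hk i j hne).false ((hσ i).some.trans (hij ▸ (hσ j).some.symm))
    exact nonempty_iso_disjointUnion
      (Equiv.ofBijective σ (Finite.injective_iff_bijective.1 hinj)) hσ
  by_cases h1 : ∀ i, k i ≠ 1
  · exact main hk fun i => h i (h1 i)
  by_cases h2 : ∀ i, k' i ≠ 1
  · exact (main hk' fun i => h' i (h2 i)).map RelIso.symm
  push Not at h2
  obtain ⟨j, hj⟩ := h2
  refine main hk fun i => ?_
  by_cases hi : k i = 1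
  · exact ⟨j, by rw [hi, hj]; exact ⟨RelIso.refl _⟩⟩
  · exact h i hi

/-- Finitely many numbers of closed walks are enough, because by Dirichlet's theorem each residue
coprime to `n` contains a large prime. -/
theorem exists_closedWalk_bound (n ℓ : ℕ) : ∃ m : ℕ,
    ∀ G ∈ cslFamily n ℓ, ∀ G' ∈ cslFamily n ℓ,
      (∀ j ≤ 2 * m, (loopedAdj (0 : ℤ) G ^ j).trace = (loopedAdj (0 : ℤ) G' ^ j).trace) →
        Nonempty (G ≃g G') := by
  have hprime : ∀ κ : ℕ, ∃ p : ℕ, CSLParam n κ →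
      p.Prime ∧ ℓ * (n * 16) < p ∧ (p : ZMod n) = κ := by
    intro κ
    by_cases h : CSLParam n κ
    · have : NeZero n := ⟨by have := h.three_le; omega⟩
      obtain ⟨p, h1, h2, h3⟩ := Nat.forall_exists_prime_gt_and_eq_mod h.isUnit (ℓ * (n * 16))
      exact ⟨p, fun _ => ⟨h2, h1, h3⟩⟩
    · exact ⟨0, fun h' => absurd h' h⟩
  choose p hp using hprime
  refine ⟨∑ κ ∈ Finset.range n, (p κ + 1), ?_⟩
  rintro G ⟨k, hk, hne, ⟨e⟩⟩ G' ⟨k', hk', hne', ⟨e'⟩⟩ htr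
  have hbound : ∀ κ, CSLParam n κ → p κ + 1 ≤ 2 * ∑ κ ∈ Finset.range n, (p κ + 1) := by
    intro κ hκ
    have := Finset.single_le_sum (f := fun κ => p κ + 1) (fun _ _ => Nat.zero_le _)
      (Finset.mem_range.2 (show κ < n by have := hκ.2; omega))
    omega
  have half : ∀ {G G' : SimpleGraph (Fin (ℓ * n))} {k k' : Fin ℓ → ℕ}
      (_ : ∀ i, CSLParam n (k i)) (_ : ∀ i, CSLParam n (k' i))
      (_ : G ≃g disjointUnion fun i => cslGraph n (k i))
      (_ : G' ≃g disjointUnion fun i => cslGraph n (k' i))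
      (_ : ∀ j ≤ 2 * ∑ κ ∈ Finset.range n, (p κ + 1),
        (loopedAdj (0 : ℤ) G ^ j).trace = (loopedAdj (0 : ℤ) G' ^ j).trace),
      ∀ i, k i ≠ 1 → ∃ j, Nonempty (cslGraph n (k i) ≃g cslGraph n (k' j)) := by
    intro G G' k k' hk hk' e e' htr i hi
    have : NeZero n := ⟨by have := (hk i).three_le; omega⟩
    obtain ⟨h1, h2, h3⟩ := hp (k i) (hk i)
    have : Fact (p (k i)).Prime := ⟨h1⟩
    exact exists_component_iso hk hk' e e' i hi h3 h2 (htr _ (hbound _ (hk i)))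
  obtain ⟨φ⟩ := nonempty_iso_of_components hne hne' (half hk hk' e e' htr)
    (half hk' hk e' e fun j hj => (htr j hj).symm)
  exact ⟨(e.trans φ).trans e'.symm⟩

/-- For transcendental `z`, the trace of `(z + A) ^ N` determines the numbers of closed walks of
length at most `N`: it is the value at `z` of an integer polynomial with coefficients
`N.choose j * tr (A ^ j)`. -/
theorem trace_loopedAdj_pow_eq_of_transcendental {V : Type} [Fintype V] [DecidableEq V] {z : ℝ}
    (hz : Transcendental ℤ z) {N : ℕ} {G G' : SimpleGraph V}
    (h : (loopedAdj z G ^ N).trace = (loopedAdj z G' ^ N).trace) (j : ℕ) (hj : j ≤ N) :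
    (loopedAdj (0 : ℤ) G ^ j).trace = (loopedAdj (0 : ℤ) G' ^ j).trace := by
  let Q : SimpleGraph V → Polynomial ℤ := fun G => ∑ j ∈ Finset.range (N + 1),
    Polynomial.C ((N.choose j : ℤ) * (loopedAdj (0 : ℤ) G ^ j).trace) * Polynomial.X ^ (N - j)
  have hQ : ∀ G, Polynomial.aeval z (Q G) = (loopedAdj z G ^ N).trace := by
    intro G
    have hc : Commute (loopedAdj 0 G) (z • (1 : Matrix V V ℝ)) :=
      (Commute.one_right _).smul_right z
    rw [loopedAdj_eq_add, hc.add_pow, Matrix.trace_sum, map_sum]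
    refine Finset.sum_congr rfl fun j _ => ?_
    have h0 := trace_loopedAdj_pow_map (Int.castRingHom ℝ) 0 G j
    rw [map_zero, eq_intCast] at h0
    rw [smul_pow, one_pow, mul_smul_comm, mul_one, smul_mul_assoc, Matrix.trace_smul,
      ← nsmul_eq_mul', Matrix.trace_smul, ← h0]
    simp only [map_mul, map_pow, Polynomial.aeval_X, Polynomial.aeval_C, smul_eq_mul,
      nsmul_eq_mul, algebraMap_int_eq, Int.coe_castRingHom, Int.cast_natCast]
    ring
  have hcoeff : ∀ G, (Q G).coeff (N - j) =
      (N.choose j : ℤ) * (loopedAdj (0 : ℤ) G ^ j).trace := by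
    intro G
    simp only [Q, Polynomial.finsetSum_coeff, Polynomial.coeff_C_mul_X_pow]
    rw [Finset.sum_eq_single j]
    · simp
    · intro i hi hij
      rw [Finset.mem_range] at hi
      rw [if_neg (by omega)]
    · intro hj'
      exact absurd (Finset.mem_range.2 (by omega)) hj'
  have hQQ : Q G = Q G' := transcendental_iff_injective.1 hz (by rw [hQ, hQ, h])
  have h2 := hcoeff G
  rw [hQQ, hcoeff G'] at h2
  exact (mul_left_cancel₀ (by exact_mod_cast (Nat.choose_pos hj).ne') h2).symm

/-! ### Perceptrons and message-passing layers -/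

/-- The perceptron `x ↦ max 0 (a * ∑ i, x i + b)`, with one hidden unit and one output. -/
def reluUnit {ι : Type} (κ : Type) (a b : ℝ) : MLP ι κ where
  width := 1
  W₁ := Matrix.of fun _ _ => a
  b₁ := fun _ => b
  W₂ := Matrix.of fun _ _ => 1
  b₂ := 0

theorem reluUnit_eval {ι κ : Type} [Fintype ι] (a b : ℝ) (x : ι → ℝ) :
    (reluUnit κ a b).eval x = fun _ => max 0 (a * ∑ i, x i + b) := by
  ext j
  change ∑ _i : Fin 1, 1 * max 0 (∑ i, a * x i + b) + 0 = _
  simp [Finset.mul_sum]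

/-- The perceptron with constant value `0`. -/
def zeroMLP (ι κ : Type) : MLP ι κ where
  width := 0
  W₁ := 0
  b₁ := 0
  W₂ := 0
  b₂ := 0

theorem zeroMLP_eval {ι κ : Type} [Fintype ι] (x : ι → ℝ) : (zeroMLP ι κ).eval x = 0 := by
  ext j
  change ∑ _i : Fin 0, (0 : ℝ) * max 0 (∑ i, 0 * x i + 0) + 0 = 0
  simp

/-- Perceptrons interpolate any function on a finite set of reals: a new largest point is served
by one more hidden unit, which vanishes at all smaller points. -/
theorem exists_MLP_eval_eq (S : Finset ℝ) (φ : ℝ → ℝ) :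
    ∃ M : MLP (Fin 1) (Fin 1), ∀ x ∈ S, M.eval (fun _ => x) = fun _ => φ x := by
  suffices h : ∃ (w : ℕ) (a b : Fin w → ℝ) (c : ℝ), ∀ x ∈ S,
      ∑ i, a i * max 0 (x + b i) + c = φ x by
    obtain ⟨w, a, b, c, h⟩ := h
    refine ⟨⟨w, Matrix.of fun _ _ => 1, b, Matrix.of fun _ i => a i, fun _ => c⟩, fun x hx => ?_⟩
    ext j
    simpa [MLP.eval, Matrix.mulVec, dotProduct] using h x hx
  induction S using Finset.induction_on_max with
  | empty => exact ⟨0, 0, 0, 0, by simp⟩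
  | insert y S hy ih =>
    obtain ⟨w, a, b, c, h⟩ := ih
    obtain ⟨u, hu, hS⟩ : ∃ u < y, ∀ x ∈ S, x ≤ u := by
      rcases S.eq_empty_or_nonempty with rfl | hne
      · exact ⟨y - 1, by linarith, by simp⟩
      · exact ⟨S.max' hne, hy _ (S.max'_mem hne), fun x hx => S.le_max' x hx⟩
    refine ⟨w + 1, Fin.cons ((φ y - (∑ i, a i * max 0 (y + b i) + c)) / (y - u)) a,
      Fin.cons (-u) b, c, fun x hx => ?_⟩
    simp only [Fin.sum_univ_succ, Fin.cons_zero, Fin.cons_succ]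
    rcases Finset.mem_insert.1 hx with rfl | hx
    · rw [max_eq_right (by linarith), ← sub_eq_add_neg,
        div_mul_cancel₀ _ (sub_ne_zero.2 hu.ne')]
      ring
    · rw [max_eq_left (by linarith [hS x hx]), mul_zero, zero_add, h x hx]

theorem GINLayer.eval_eq {ι κ V : Type} [Fintype ι] [Fintype V] (z : ℝ) (M : MLP ι κ)
    (G : SimpleGraph V) (x : V → ι → ℝ) (v : V) :
    (GINLayer.mk (z - 1) M).eval G x v = M.eval fun i => ∑ u, loopedAdj z G v u * x u i := by
  classical
  unfold GINLayer.eval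
  congr 1
  ext i
  have hsplit : ∀ u, loopedAdj z G v u * x u i =
      (if v = u then z * x u i else 0) + if G.Adj v u then x u i else 0 := by
    intro u
    by_cases hu : v = u
    · subst hu
      simp [loopedAdj]
    · by_cases ha : G.Adj v u <;> simp [loopedAdj, hu, ha]
  simp only [hsplit, Finset.sum_add_distrib, Finset.sum_ite_eq, Finset.mem_univ, if_true,
    Pi.add_apply, Pi.smul_apply, smul_eq_mul, Finset.sum_apply, Finset.sum_filter,
    add_sub_cancel]
  congr 1
  exact Finset.sum_congr rfl fun u _ => by split_ifs <;> rfl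

/-- The marking after `m` multiplications by `z + A`: the column of `(z + A) ^ m` at the marked
node, or `0` if no node is marked. -/
noncomputable def markPower {V : Type} [Fintype V] [DecidableEq V] (z : ℝ) (G : SimpleGraph V)
    (m : ℕ) :
    Option V → V → ℝ
  | none, _ => 0
  | some r, v => (loopedAdj z G ^ m) v r

theorem markPower_nonneg {V : Type} [Fintype V] [DecidableEq V] {z : ℝ} (hz : 0 ≤ z)
    (G : SimpleGraph V) (m : ℕ) (s : Option V) (v : V) : 0 ≤ markPower z G m s v := by
  cases s with
  | none => exact le_rfl
  | some r => exact loopedAdj_pow_nonneg hz G m v r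

theorem sum_loopedAdj_mul_markPower {V : Type} [Fintype V] [DecidableEq V] (z : ℝ)
    (G : SimpleGraph V) (m : ℕ) (s : Option V) (v : V) :
    ∑ u, loopedAdj z G v u * markPower z G m s u = markPower z G (m + 1) s v := by
  cases s with
  | none => simp [markPower]
  | some r => simp only [markPower, pow_succ', Matrix.mul_apply]

theorem sum_markPower_sq {V : Type} [Fintype V] [DecidableEq V] (z : ℝ)
    (G : SimpleGraph V) (m : ℕ) (r : V) :
    ∑ v, markPower z G m (some r) v ^ 2 = (loopedAdj z G ^ (2 * m)) r r := by
  have ht : (loopedAdj z G ^ m).transpose = loopedAdj z G ^ m := by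
    rw [Matrix.transpose_pow, loopedAdj_transpose]
  rw [two_mul, pow_add, Matrix.mul_apply]
  refine Finset.sum_congr rfl fun v _ => ?_
  simp only [markPower, sq]
  congr 1
  conv_lhs => rw [← ht]
  rfl

/-- The encoder layer that applies the perceptron `M` to `z + A` times the markings and sets the
features to `0`. -/
def markingLayer {ι : Type} (z : ℝ) (M : MLP ι (Fin 1)) : EncoderLayer ι (Fin 1) where
  p := ⟨z - 1, M⟩
  h := ⟨0, zeroMLP _ _⟩

theorem markingLayer_eval {ι V : Type} [Fintype ι] [Fintype V] [DecidableEq V]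
    (z : ℝ) (M : MLP ι (Fin 1)) (G : SimpleGraph V) (m : ℕ) (s : Option V) (h : V → ι → ℝ) :
    (markingLayer z M).eval G ⟨fun v _ => markPower z G m s v, h⟩ =
      ⟨fun v => M.eval fun _ => markPower z G (m + 1) s v, 0⟩ := by
  simp only [markingLayer, EncoderLayer.eval, EncoderState.mk.injEq]
  constructor
  · ext1 v
    rw [GINLayer.eval_eq]
    simp only [sum_loopedAdj_mul_markPower]
  · ext1 v
    simp only [GINLayer.eval, zeroMLP_eval]
    rfl

/-- The rectifier acts as the identity on the nonnegative markings. -/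
theorem markingLayer_reluUnit_eval {ι V : Type} [Fintype ι] [Unique ι] [Fintype V] [DecidableEq V]
    {z : ℝ} (hz : 0 ≤ z) (G : SimpleGraph V) (m : ℕ) (s : Option V) (h : V → ι → ℝ) :
    (markingLayer z (reluUnit (Fin 1) 1 0)).eval G ⟨fun v _ => markPower z G m s v, h⟩ =
      ⟨fun v _ => markPower z G (m + 1) s v, 0⟩ := by
  rw [markingLayer_eval]
  simp only [reluUnit_eval, Finset.univ_unique, Finset.sum_singleton, one_mul, add_zero,
    max_eq_right (markPower_nonneg hz G (m + 1) s _)]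

/-- The encoder of `m + 1` linear layers followed by the layers `rest`. -/
def powerEncoder (z : ℝ) (m : ℕ) (rest : List (EncoderLayer (Fin 1) (Fin 1))) : Encoder 1 where
  first := markingLayer z (reluUnit _ 1 0)
  rest := List.replicate m (markingLayer z (reluUnit _ 1 0)) ++ rest

theorem powerEncoder_eval {V : Type} [Fintype V] [DecidableEq V] {z : ℝ} (hz : 0 ≤ z) (m : ℕ)
    (rest : List (EncoderLayer (Fin 1) (Fin 1))) (G : SimpleGraph V) (s : Option V)
    {out : EncoderState V (Fin 1)}
    (hout : rest.foldl (fun st N => EncoderLayer.eval N G st)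
      ⟨fun v _ => markPower z G (m + 1) s v, 0⟩ = out) :
    (powerEncoder z m rest).eval G s = out.p + out.h := by
  have h0 : (initState s : EncoderState V Unit) =
      ⟨fun v _ => markPower z G 0 s v, fun _ _ => 1⟩ := by
    simp only [initState, EncoderState.mk.injEq, and_true]
    ext v _
    cases s with
    | none => simp [markPower]
    | some r => simp [markPower, Matrix.one_apply, eq_comm]
  have hl : ∀ (m i : ℕ), (List.replicate m (markingLayer z (reluUnit (Fin 1) 1 0))).foldl
      (fun st N => N.eval G st)
      (⟨fun v _ => markPower z G i s v, 0⟩ : EncoderState V (Fin 1)) =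
        ⟨fun v _ => markPower z G (m + i) s v, 0⟩ := by
    intro m
    induction m with
    | zero => intro i; simp
    | succ m ih =>
      intro i
      rw [List.replicate_succ, List.foldl_cons, markingLayer_reluUnit_eval hz, ih]
      simp only [add_assoc, add_comm 1 i]
  simp only [Encoder.eval, powerEncoder, h0, markingLayer_reluUnit_eval hz, zero_add,
    List.foldl_append, hl, hout]

/-! ### Bags with one root in each visited component -/

theorem bagMean_cons_map_some {V : Type} (R : Finset V) (F : Option V → Fin 1 → ℝ)
    (h : F none = 0) (i : Fin 1) :
    bagMean (none ::ₘ R.val.map some) F i = ((R.card : ℝ) + 1)⁻¹ * ∑ r ∈ R, F (some r) i := by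
  have hs : ((none ::ₘ R.val.map some).map F).sum = ∑ r ∈ R, F (some r) := by
    rw [Multiset.map_cons, Multiset.sum_cons, h, zero_add, Multiset.map_map]
    rfl
  unfold bagMean
  rw [hs]
  simp

/-- The bag consists of the unmarked graph and of `t` marked graphs, with roots in pairwise
different components; `c v` is the component of `v`. -/
def IsPartialTransversal {V : Type} {ℓ : ℕ} (c : V → Fin ℓ) (t : ℕ)
    (B : Multiset (Option V)) : Prop :=
  ∃ R : Finset V, R.card = t ∧ Set.InjOn c R ∧ B = none ::ₘ R.val.map some

theorem IsPartialTransversal.cons {V : Type} {ℓ : ℕ} {c : V → Fin ℓ} {R : Finset V}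
    (hR : Set.InjOn c R) {v : V} (hv : ∀ r ∈ R, c r ≠ c v) :
    IsPartialTransversal c (R.card + 1) (some v ::ₘ none ::ₘ R.val.map some) := by
  classical
  have hvR : v ∉ R := fun h => hv v h rfl
  refine ⟨insert v R, Finset.card_insert_of_notMem hvR, ?_, ?_⟩
  · rw [Finset.coe_insert, Set.injOn_insert (by simpa using hvR)]
    exact ⟨hR, fun ⟨r, hr, he⟩ => hv r hr he⟩
  · rw [Finset.insert_val_of_notMem hvR, Multiset.map_cons, Multiset.cons_swap]

/-- The selection network: `n + 1` lazy walk steps spread each marking over its whole component and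
nowhere else. The readout `x ↦ max 0 (1 - (ℓ + 1) x)` then vanishes on the visited components,
where the mean over a bag of at most `ℓ + 1` subgraphs is at least `(ℓ + 1)⁻¹`. -/
def cslSelection (n ℓ : ℕ) : SelectionNetwork where
  c := 1
  encoder := powerEncoder 1 n []
  out := reluUnit Unit (-(ℓ + 1)) 1

theorem cslSelection_eval {V : Type} [Fintype V] [DecidableEq V] (n ℓ : ℕ) (G : SimpleGraph V)
    (R : Finset V) (v : V) :
    (cslSelection n ℓ).eval G (none ::ₘ R.val.map some) v =
      max 0 (1 - (ℓ + 1) * (((R.card : ℝ) + 1)⁻¹ *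
        ∑ r ∈ R, (loopedAdj 1 G ^ (n + 1)) v r)) := by
  have henc : ∀ s, (powerEncoder 1 n []).eval G s v = fun _ => markPower 1 G (n + 1) s v := by
    intro s
    rw [powerEncoder_eval zero_le_one n [] G s rfl]
    ext i
    exact add_zero _
  have h := bagMean_cons_map_some R (fun s _ => markPower 1 G (n + 1) s v) rfl 0
  change (reluUnit Unit (-((ℓ : ℝ) + 1)) 1).eval (bagMean (none ::ₘ R.val.map some)
    fun s => (powerEncoder 1 n []).eval G s v) () = _
  simp only [henc, reluUnit_eval, Finset.univ_unique, Finset.sum_singleton, Fin.default_eq_zero,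
    h]
  simp only [markPower]
  congr 1
  ring

section Selection

variable {V : Type} [Fintype V] [DecidableEq V] {n ℓ : ℕ} {k : Fin ℓ → ℕ} {G : SimpleGraph V}

theorem cslSelection_eval_of_notMem (e : G ≃g disjointUnion fun i => cslGraph n (k i))
    (hk : ∀ i, CSLParam n (k i)) {R : Finset V} {v : V} (hv : ∀ r ∈ R, (e r).1 ≠ (e v).1) :
    (cslSelection n ℓ).eval G (none ::ₘ R.val.map some) v = 1 := by
  have : NeZero n := ⟨by have := (hk (e v).1).three_le; omega⟩
  rw [cslSelection_eval, Finset.sum_eq_zero]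
  · simp
  · intro r hr
    rw [loopedAdj_pow_apply_of_iso e, if_neg (hv r hr).symm]

theorem cslSelection_eval_of_mem (e : G ≃g disjointUnion fun i => cslGraph n (k i))
    (hk : ∀ i, CSLParam n (k i)) {R : Finset V} (hR : R.card ≤ ℓ) {v r : V} (hr : r ∈ R)
    (hv : (e r).1 = (e v).1) :
    (cslSelection n ℓ).eval G (none ::ₘ R.val.map some) v = 0 := by
  have : NeZero n := ⟨by have := (hk (e v).1).three_le; omega⟩
  have h1 : 1 ≤ (loopedAdj (1 : ℝ) G ^ (n + 1)) v r := by
    rw [loopedAdj_pow_apply_of_iso e, if_pos hv.symm]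
    have h := one_le_loopedAdj_cslGraph_pow (hk (e v).1) (n + 1) ((e r).2 - (e v).2).val
      ((ZMod.val_lt _).le.trans (Nat.le_succ n)) (e v).2
    rwa [ZMod.natCast_zmod_val, add_sub_cancel] at h
  have h2 : 1 ≤ ∑ r ∈ R, (loopedAdj (1 : ℝ) G ^ (n + 1)) v r :=
    h1.trans (Finset.single_le_sum (f := fun r => (loopedAdj (1 : ℝ) G ^ (n + 1)) v r)
      (fun _ _ => loopedAdj_pow_nonneg zero_le_one _ _ _ _) hr)
  rw [cslSelection_eval, max_eq_left]
  have hc : (0 : ℝ) < (R.card : ℝ) + 1 := by positivity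
  have hcl : (R.card : ℝ) + 1 ≤ ℓ + 1 := by exact_mod_cast Nat.succ_le_succ hR
  rw [sub_nonpos, inv_mul_eq_div, mul_div_assoc', le_div_iff₀ hc, one_mul]
  nlinarith

/-- As long as there is an unvisited component, a draw does not fail, and its outcome lies in an
unvisited component. -/
theorem bagLaw_cslSelection_support (e : G ≃g disjointUnion fun i => cslGraph n (k i))
    (hk : ∀ i, CSLParam n (k i)) (t : ℕ) (ht : t ≤ ℓ) :
    ∀ x ∈ (bagLaw (cslSelection n ℓ) G t).support,
      ∃ B, x = some B ∧ IsPartialTransversal (fun v => (e v).1) t B := by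
  induction t with
  | zero =>
    intro x hx
    rw [bagLaw, PMF.mem_support_pure_iff] at hx
    exact ⟨_, hx, ∅, by simp⟩
  | succ t ih =>
    intro x hx
    rw [bagLaw, PMF.mem_support_bind_iff] at hx
    obtain ⟨y, hy, hx⟩ := hx
    obtain ⟨B, rfl, R, hRt, hinj, rfl⟩ := ih (by omega) y hy
    simp only [PMF.mem_support_map_iff] at hx
    obtain ⟨w, hw, rfl⟩ := hx
    have hzero : ∀ {v r}, r ∈ R → (e r).1 = (e v).1 →
        (cslSelection n ℓ).eval G (none ::ₘ R.val.map some) v = 0 :=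
      fun hr hv => cslSelection_eval_of_mem e hk (by omega) hr hv
    obtain ⟨i, hi⟩ : ∃ i, i ∉ R.image fun v => (e v).1 := by
      by_contra! hall
      have h1 : (Finset.univ : Finset (Fin ℓ)).card ≤ (R.image fun v => (e v).1).card :=
        Finset.card_le_card fun i _ => hall i
      have h2 := Finset.card_image_le (s := R) (f := fun v => (e v).1)
      rw [Finset.card_univ, Fintype.card_fin] at h1
      omega
    have hnonneg : ∀ v, 0 ≤ (cslSelection n ℓ).eval G (none ::ₘ R.val.map some) v := by
      intro v
      rw [cslSelection_eval]
      exact le_max_left _ _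
    have hun : IsUnnormalized ((cslSelection n ℓ).eval G (none ::ₘ R.val.map some)) := by
      refine ⟨hnonneg, Finset.sum_pos' (fun v _ => hnonneg v)
        ⟨e.symm (i, 0), Finset.mem_univ _, ?_⟩⟩
      rw [cslSelection_eval_of_notMem e hk]
      · exact one_pos
      · intro r hr hri
        rw [e.apply_symm_apply] at hri
        exact hi (Finset.mem_image.2 ⟨r, hr, hri⟩)
    rw [draw, dif_pos hun, PMF.mem_support_map_iff] at hw
    obtain ⟨v, hv, rfl⟩ := hw
    rw [PMF.mem_support_normalize_iff] at hv
    refine ⟨_, rfl, ?_⟩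
    rw [← hRt]
    refine IsPartialTransversal.cons hinj fun r hr hrv => hv ?_
    rw [hzero hr hrv, ENNReal.ofReal_zero]

end Selection

/-! ### The prediction network -/

/-- The invariant computed by the architecture: up to a constant, the trace of
`(z + A) ^ (2 * m)`. -/
noncomputable def traceInvariant {V : Type} [Fintype V] [DecidableEq V] (n ℓ : ℕ) (z : ℝ) (m : ℕ)
    (G : SimpleGraph V) : Fin 1 → ℝ :=
  fun _ => ((ℓ : ℝ) + 1)⁻¹ * ((Fintype.card V : ℝ)⁻¹ *
    ((n : ℝ)⁻¹ * (loopedAdj z G ^ (2 * m)).trace))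

/-- The sum of the diagonal entries at one root per component is the trace divided by `n`, since
each of the components has `n` nodes with the same diagonal entry. -/
theorem sum_loopedAdj_pow_roots {V : Type} [Fintype V] [DecidableEq V] {n ℓ : ℕ} {k : Fin ℓ → ℕ}
    {G : SimpleGraph V} (e : G ≃g disjointUnion fun i => cslGraph n (k i))
    (hk : ∀ i, CSLParam n (k i)) (z : ℝ) (m : ℕ) {R : Finset V}
    (hinj : Set.InjOn (fun v => (e v).1) R) (hR : R.card = ℓ) :
    ∑ r ∈ R, (loopedAdj z G ^ m) r r = (n : ℝ)⁻¹ * (loopedAdj z G ^ m).trace := by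
  rcases Nat.eq_zero_or_pos ℓ with rfl | hℓ
  · have : IsEmpty V := ⟨fun v => (e v).1.elim0⟩
    simp [Finset.eq_empty_of_isEmpty R, Matrix.trace]
  have : NeZero n := ⟨by have := (hk ⟨0, hℓ⟩).three_le; omega⟩
  have himg : R.image (fun v => (e v).1) = Finset.univ := by
    rw [← Finset.card_eq_iff_eq_univ, Finset.card_image_of_injOn hinj, hR, Fintype.card_fin]
  rw [trace_loopedAdj_pow_of_iso e, Finset.mul_sum, ← himg, Finset.sum_image hinj]
  refine Finset.sum_congr rfl fun r _ => ?_
  rw [loopedAdj_pow_apply_of_iso e, if_pos rfl, loopedAdj_cslGraph_pow_diag (hk _)]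

/-- The last layer squares the entries of `(z + A) ^ (m + 2)` in the column of the root, and their
sum over the nodes is the diagonal entry of `(z + A) ^ (2 * (m + 2))` at the root. -/
theorem exists_predictionNetwork (n ℓ : ℕ) (V : Type) [Fintype V] [DecidableEq V] {z : ℝ}
    (hz : 0 ≤ z) (m : ℕ) :
    ∃ g : PredictionNetwork 1, ∀ (G : SimpleGraph V) (k : Fin ℓ → ℕ)
      (e : G ≃g disjointUnion fun i => cslGraph n (k i)), (∀ i, CSLParam n (k i)) →
      ∀ B, IsPartialTransversal (fun v => (e v).1) ℓ B →
        g.eval G B = traceInvariant n ℓ z (m + 2) G := by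
  obtain ⟨M, hM⟩ := exists_MLP_eval_eq
    (Set.finite_range fun x : SimpleGraph V × Option V × V =>
      markPower z x.1 (m + 2) x.2.1 x.2.2).toFinset fun x => x ^ 2
  refine ⟨⟨1, powerEncoder z m [markingLayer z M], reluUnit _ 1 0⟩, ?_⟩
  rintro G k e hk B ⟨R, hR, hinj, rfl⟩
  have henc : ∀ s v, (powerEncoder z m [markingLayer z M]).eval G s v =
      fun _ => markPower z G (m + 2) s v ^ 2 := by
    intro s v
    rw [powerEncoder_eval hz m [_] G s (markingLayer_eval z M G (m + 1) s 0), add_zero]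
    exact hM _ (by simp only [Set.Finite.mem_toFinset]; exact ⟨(G, s, v), rfl⟩)
  have hnode : ∀ s, (bagMean (Finset.univ : Finset V).val fun v =>
      (powerEncoder z m [markingLayer z M]).eval G s v) =
        fun _ => (Fintype.card V : ℝ)⁻¹ * ∑ v, markPower z G (m + 2) s v ^ 2 := by
    intro s
    ext i
    simp only [bagMean, henc]
    change (_ • ∑ v, fun _ : Fin 1 => markPower z G (m + 2) s v ^ 2) i = _
    simp [Finset.sum_apply]
  have hbag := bagMean_cons_map_some R (fun s => bagMean (Finset.univ : Finset V).val fun v =>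
    (powerEncoder z m [markingLayer z M]).eval G s v)
    (by rw [hnode]; ext; simp [markPower]) 0
  simp only [hnode, sum_markPower_sq, ← Finset.mul_sum, hR] at hbag
  rw [sum_loopedAdj_pow_roots e hk z _ hinj hR] at hbag
  have hpos : 0 ≤ traceInvariant n ℓ z (m + 2) G 0 := by
    have htr : 0 ≤ (loopedAdj z G ^ (2 * (m + 2))).trace :=
      Finset.sum_nonneg fun v _ => loopedAdj_pow_nonneg hz G _ v v
    unfold traceInvariant
    positivity
  change (reluUnit (Fin 1) 1 0).eval (bagMean (none ::ₘ R.val.map some) fun s =>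
    bagMean (Finset.univ : Finset V).val fun v =>
      (powerEncoder z m [markingLayer z M]).eval G s v) = _
  ext i
  obtain rfl : i = 0 := Subsingleton.elim _ _
  simp only [reluUnit_eval, hnode, Finset.univ_unique, Finset.sum_singleton, Fin.default_eq_zero,
    hbag, one_mul, add_zero]
  exact max_eq_right hpos

/-- The invariant separates the family. -/
theorem traceInvariant_eq_iff {n ℓ m : ℕ} {z : ℝ} (hz : Transcendental ℤ z)
    (hm : ∀ G ∈ cslFamily n ℓ, ∀ G' ∈ cslFamily n ℓ,
      (∀ j ≤ 2 * m, (loopedAdj (0 : ℤ) G ^ j).trace = (loopedAdj (0 : ℤ) G' ^ j).trace) →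
        Nonempty (G ≃g G'))
    {G G' : SimpleGraph (Fin (ℓ * n))} (hG : G ∈ cslFamily n ℓ) (hG' : G' ∈ cslFamily n ℓ) :
    traceInvariant n ℓ z (m + 2) G = traceInvariant n ℓ z (m + 2) G' ↔ Nonempty (G ≃g G') := by
  constructor
  · intro h
    refine hm G hG G' hG' fun j hj =>
      trace_loopedAdj_pow_eq_of_transcendental hz (N := 2 * (m + 2)) ?_ j (by omega)
    rcases Nat.eq_zero_or_pos ℓ with rfl | hℓ
    · have : IsEmpty (Fin (0 * n)) := by rw [zero_mul]; infer_instance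
      simp [Matrix.trace]
    · obtain ⟨k, hk, -⟩ := hG
      have hn : n ≠ 0 := by have := (hk ⟨0, hℓ⟩).three_le; omega
      have hn' : (n : ℝ) ≠ 0 := Nat.cast_ne_zero.2 hn
      have hcard : ((ℓ * n : ℕ) : ℝ) ≠ 0 := Nat.cast_ne_zero.2 (Nat.mul_ne_zero hℓ.ne' hn)
      have h0 := congrFun h 0
      simp only [traceInvariant, Fintype.card_fin] at h0
      have hl : (ℓ : ℝ) + 1 ≠ 0 := by positivity
      exact mul_left_cancel₀ (inv_ne_zero hn') (mul_left_cancel₀ (inv_ne_zero hcard)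
        (mul_left_cancel₀ (inv_ne_zero hl) h0))
  · rintro ⟨φ⟩
    ext i
    unfold traceInvariant
    rw [trace_loopedAdj_pow_eq_of_iso φ]

theorem mainTheorem1 (n ℓ : ℕ) :
    ∃ (f : SelectionNetwork) (d : ℕ) (g : PredictionNetwork d)
      (isoType : SimpleGraph (Fin (ℓ * n)) → Fin d → ℝ),
      (∀ G ∈ cslFamily n ℓ, ∀ G' ∈ cslFamily n ℓ,
        (isoType G = isoType G' ↔ Nonempty (G ≃g G'))) ∧
      ∀ G ∈ cslFamily n ℓ, outputLaw f g ℓ G (some (isoType G)) = 1 := by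
  obtain ⟨m, hm⟩ := exists_closedWalk_bound n ℓ
  have hz : Transcendental ℤ (liouvilleNumber (2 : ℕ)) := transcendental_liouvilleNumber le_rfl
  have hz0 : 0 ≤ liouvilleNumber (2 : ℕ) := tsum_nonneg fun i => by positivity
  obtain ⟨g, hg⟩ := exists_predictionNetwork n ℓ (Fin (ℓ * n)) hz0 m
  refine ⟨cslSelection n ℓ, 1, g, traceInvariant n ℓ (liouvilleNumber (2 : ℕ)) (m + 2),
    fun G hG G' hG' => traceInvariant_eq_iff hz hm hG hG', ?_⟩
  rintro G ⟨k, hk, -, ⟨e⟩⟩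
  rw [PMF.apply_eq_one_iff]
  refine (PMF.support_nonempty _).subset_singleton_iff.1 fun y hy => ?_
  rw [outputLaw, PMF.mem_support_map_iff] at hy
  obtain ⟨x, hx, rfl⟩ := hy
  obtain ⟨B, rfl, hB⟩ := bagLaw_cslSelection_support e hk ℓ le_rfl x hx
  rw [Set.mem_singleton_iff, Option.map_some, hg G k e hk B hB]
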